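/- Let $\Lambda=\mathbb C[p_1,p_2,p_3,\dots]$ be the ring of symmetric functions, written as the polynomial ring in the power sums, and let the Bernstein operators $B_n$ ($n\in\mathbb Z$) on $\Lambda$ be defined by $$\sum_{n\in\mathbb Z}B_nt^n=\exp\Big(\sum_{k\ge1}\frac{t^k}{k}p_k\Big)\exp\Big(-\sum_{k\ge1}t^{-k}\frac{\partial}{\partial p_k}\Big).$$ For a composition $\mu=(\mu_1,\dots,\mu_l)$, $\mu_i\in\mathbb Z$, $l\ge0$, put $B_\mu=B_{\mu_1}B_{\mu_2}\cdots B_{\mu_l}$. The code of $\mu$ is the doubly infinite sequence of letters $R$, $L$, $U$ (unit steps right, left, up) obtained by going up the negative $y$-axis to the point $(0,-l)$, then along the right edge of the diagram of $\mu$ (rows $\mu_1,\dots,\mu_l$ from top to bottom, so that the up step in the $i$-th row has abscissa $\mu_i$) up to the $x$-axis, and then to the right forever, with no adjacent $LR$ or $RL$. The place in the sequence of the point $(0,-l)$ is part of the code, so that the code determines $\mu$ also if its last parts are $0$. A sequence, with such a marked place, that becomes the code of $\mu$ after finitely many deletions of adjacent pairs $LR$ or $RL$ after the marked place is also called a (non-reduced)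 code of $\mu$. If $\alpha$ is a code of $\mu$ and $\beta$ is a code of $\nu$, write $\alpha\sim\pm\beta$ if $B_\mu=\pm B_\nu$, and $\alpha\sim0$ if $B_\mu=0$. For finite words $\alpha_1,\beta_1$ in $R,L,U$, write $\alpha_1\sim\pm\beta_1$ if $\alpha_0\alpha_1\alpha_2\sim\pm\alpha_0\beta_1\alpha_2$ for all $\alpha_0=\dots UUU\,a$ and $\alpha_2=c\,RRR\dots$ with finite words $a,c$, where the marked place on both sides is immediately before $a$ (both sides are then codes of compositions); similarly, write $\alpha_1\sim0$ if $\alpha_0\alpha_1\alpha_2\sim0$ for all such $\alpha_0,\alpha_2$. Negative powers of a letter are read by $R^{-1}=L$. Then, for every positive integer $k$, $$R\,(L^kUR^{k-1})\sim(L^{k-1}UR^{k-2})\,R,\qquad U\,(L^kUR^{k-1})\sim-(L^{k-1}UR^{k-2})\,U.$$ Moreover, $ULU\sim0$. -/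

import Mathlib

noncomputable section

namespace Bernstein

/-! ## The Bernstein operators on the ring of symmetric functions -/

/-- The ring of symmetric functions `Λ = ℂ[p₁, p₂, p₃, …]`, the polynomial ring in the power
sums; the variable `MvPolynomial.X k` is the power sum `p_k`, for `k ≥ 1`. -/
abbrev Sym : Type := MvPolynomial ℕ+ ℂ

/-- Formal power series in one variable whose coefficients are linear operators on `Λ`
(the product of coefficients is composition). -/
abbrev OpSeries : Type := PowerSeries (Module.End ℂ Sym)

/-- The exponential `∑_j F ^ j / j!` of an operator series without constant term.  Since `F ^ j`
has no terms of degree less than `j`, only `j ≤ n` contribute to the `n`-th coefficient. -/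
def expSeries (F : OpSeries) : OpSeries :=
  PowerSeries.mk fun n =>
    ∑ j ∈ Finset.range (n + 1), ((j.factorial : ℂ)⁻¹) • PowerSeries.coeff n (F ^ j)

/-- `∑_{k ≥ 1} (t ^ k / k) p_k`, where `p_k` acts on `Λ` by multiplication. -/
def creationExponent : OpSeries :=
  PowerSeries.mk fun k =>
    if h : 0 < k then ((k : ℂ)⁻¹) • LinearMap.mulLeft ℂ (MvPolynomial.X (k.toPNat h) : Sym) else 0

/-- `-∑_{k ≥ 1} u ^ k ∂/∂p_k`, where `u = t⁻¹`. -/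
def annihilationExponent : OpSeries :=
  PowerSeries.mk fun k =>
    if h : 0 < k then -((MvPolynomial.pderiv (k.toPNat h) : Derivation ℂ Sym Sym) : Sym →ₗ[ℂ] Sym) else 0

/-- The coefficient of `t ^ a` in `exp (∑_{k ≥ 1} (t ^ k / k) p_k)`. -/
def creation (a : ℕ) : Module.End ℂ Sym := PowerSeries.coeff a (expSeries creationExponent)

/-- The coefficient of `t ^ (-b)` in `exp (-∑_{k ≥ 1} t ^ (-k) ∂/∂p_k)`. -/
def annihilation (b : ℕ) : Module.End ℂ Sym :=
  PowerSeries.coeff b (expSeries annihilationExponent)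

/-- The weight of a monomial in the `p_k`, where `p_k` has weight `k`. -/
def wt (m : ℕ+ →₀ ℕ) : ℕ := m.sum fun k e => e * (k : ℕ)

/-- `F` is lowering: its coefficient of `u ^ b` lowers weights by at least `b`. -/
def Lowering (F : OpSeries) : Prop :=
  ∀ (b d : ℕ) (f : Sym), (∀ m ∈ f.support, wt m ≤ d) →
    ∀ m ∈ (PowerSeries.coeff b F f).support, wt m + b ≤ d

theorem lowering_one : Lowering 1 := by
  intro b d f hf m hm
  rw [PowerSeries.coeff_one] at hm
  split_ifs at hm with hb
  · subst hb
    simpa using hf m (by simpa using hm)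
  · simp at hm

theorem support_sum_exists {ι : Type*} (s : Finset ι) (g : ι → Sym) (m : ℕ+ →₀ ℕ)
    (hm : m ∈ (∑ i ∈ s, g i).support) : ∃ i ∈ s, m ∈ (g i).support := by
  by_contra hcon
  push Not at hcon
  rw [MvPolynomial.mem_support_iff, MvPolynomial.coeff_sum] at hm
  exact hm (Finset.sum_eq_zero fun i hi => MvPolynomial.notMem_support_iff.mp (hcon i hi))

theorem Lowering.mul {F G : OpSeries} (hF : Lowering F) (hG : Lowering G) :
    Lowering (F * G) := by
  intro b d f hf m hm
  rw [PowerSeries.coeff_mul, LinearMap.sum_apply] at hm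
  obtain ⟨⟨i, j⟩, hij, hm⟩ := support_sum_exists _ _ _ hm
  replace hij : i + j = b := Finset.HasAntidiagonal.mem_antidiagonal.mp hij
  simp only at hm
  rw [Module.End.mul_apply] at hm
  by_cases hjd : j ≤ d
  · have h1 : ∀ m ∈ (PowerSeries.coeff j G f).support, wt m ≤ d - j := fun m' hm' => by
      have := hG j d f hf m' hm'
      omega
    have := hF i (d - j) _ h1 m hm
    omega
  · have h0 : PowerSeries.coeff j G f = 0 := by
      rw [← MvPolynomial.support_eq_empty, Finset.eq_empty_iff_forall_notMem]
      intro m' hm'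
      have := hG j d f hf m' hm'
      omega
    rw [h0] at hm
    simp at hm

theorem Lowering.pow {F : OpSeries} (hF : Lowering F) (j : ℕ) : Lowering (F ^ j) := by
  induction j with
  | zero => simpa using lowering_one
  | succ j ih => rw [pow_succ]; exact ih.mul hF

theorem lowering_annihilationExponent : Lowering annihilationExponent := by
  intro b d f hf m hm
  rw [annihilationExponent, PowerSeries.coeff_mk] at hm
  split_ifs at hm with hb
  · have hm' : m ∈ (MvPolynomial.pderiv (b.toPNat hb) f).support := by
      rwa [LinearMap.neg_apply, MvPolynomial.support_neg] at hm
    rw [MvPolynomial.mem_support_iff, MvPolynomial.coeff_pderiv] at hm'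
    have h2 := hf _ (MvPolynomial.mem_support_iff.mpr (left_ne_zero_of_mul hm'))
    have h3 : wt (m + Finsupp.single (b.toPNat hb) 1) = wt m + b := by
      unfold wt
      rw [Finsupp.sum_add_index' (by simp) (by intros; ring), Finsupp.sum_single_index (by simp), one_mul]
      rfl
    omega
  · simp at hm

theorem annihilation_eq_zero (f : Sym) :
    ∃ d : ℕ, ∀ b, d < b → annihilation b f = 0 := by
  refine ⟨f.support.sup wt, fun b hb => ?_⟩
  rw [← MvPolynomial.support_eq_empty, Finset.eq_empty_iff_forall_notMem]
  intro m hm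
  rw [annihilation, expSeries, PowerSeries.coeff_mk, LinearMap.sum_apply] at hm
  obtain ⟨j, -, hm⟩ := support_sum_exists _ _ _ hm
  rw [LinearMap.smul_apply] at hm
  have h1 := lowering_annihilationExponent.pow j b (f.support.sup wt) f
    (fun m' hm' => Finset.le_sup hm') m (MvPolynomial.support_smul hm)
  omega

/-- The contribution to the coefficient of `t ^ n` in `B(t)` of the coefficient of `t ^ (-b)` in
the second exponential. -/
def bernsteinTerm (n : ℤ) (b : ℕ) : Module.End ℂ Sym :=
  if 0 ≤ n + b then creation (n + b).toNat * annihilation b else 0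

theorem bernsteinTerm_finite (n : ℤ) (f : Sym) :
    (Function.support fun b => bernsteinTerm n b f).Finite := by
  obtain ⟨d, hd⟩ := annihilation_eq_zero f
  refine (Set.finite_Iic d).subset fun b hb => ?_
  by_contra hlt
  refine hb ?_
  have := hd b (by simpa using hlt)
  simp only [bernsteinTerm]
  split_ifs
  · rw [Module.End.mul_apply, this, map_zero]
  · rfl

/-- The Bernstein operator `B_n`, `n ∈ ℤ`: the coefficient of `t ^ n` in
`B(t) = exp (∑_{k ≥ 1} (t ^ k / k) p_k) exp (-∑_{k ≥ 1} t ^ (-k) ∂/∂p_k)`.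
On each `f` only finitely many terms of the sum are nonzero (`bernsteinTerm_finite`). -/
def B (n : ℤ) : Module.End ℂ Sym where
  toFun f := ∑ᶠ b : ℕ, bernsteinTerm n b f
  map_add' f g := by
    simp only [map_add]
    exact finsum_add_distrib (bernsteinTerm_finite n f) (bernsteinTerm_finite n g)
  map_smul' c f := by
    simp only [map_smul, RingHom.id_apply]
    exact (smul_finsum c _).symm

/-- `B_μ = B_{μ₁} B_{μ₂} ⋯ B_{μ_l}` for a composition `μ = (μ₁, …, μ_l)` with integer parts. -/
def BComp (μ : List ℤ) : Module.End ℂ Sym := (μ.map B).prod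

/-! ## Extended codes -/

/-- The unit steps: right, left, up. -/
inductive Letter : Type
  | R | L | U
  deriving DecidableEq

open Letter

/-- The word `R ^ n`, `n ∈ ℤ`, with `R⁻¹ = L`. -/
def Rpow (n : ℤ) : List Letter :=
  List.replicate n.toNat R ++ List.replicate (-n).toNat L

/-- The word `L ^ n`, `n ∈ ℤ`, with `L⁻¹ = R`. -/
def Lpow (n : ℤ) : List Letter := Rpow (-n)

/-- The path which starts at horizontal position `x` and has its successive up steps, from bottom
to top, at the horizontal positions given by the list. -/
def edgeWord : ℤ → List ℤ → List Letter
  | _, [] => []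
  | x, m :: rows => Rpow (m - x) ++ U :: edgeWord m rows

/-- The doubly infinite sequence `…UUU w RRR…`: the negative `y`-axis up to a chosen point, where
index `0` is placed, then the steps of `w`, then only right steps along the positive `x`-axis. -/
def extend (w : List Letter) : ℤ → Letter :=
  fun i => if i < 0 then U else w.getD i.toNat R

/-- The code of `μ = (μ₁, …, μ_l)`, traced along the right edge of its diagram, whose rows are
listed from top to bottom.  Index `0` is placed at the bottom left corner `(0, -l)` of the
diagram, which records the number `l` of rows also when the last parts of `μ` are zero. -/
def code (μ : List ℤ) : ℤ → Letter := extend (edgeWord 0 μ.reverse)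

/-- `β` arises from `α` by deleting two adjacent letters `LR` or `RL`. -/
def Cancel (α β : ℤ → Letter) : Prop :=
  ∃ i : ℤ, 0 ≤ i ∧ ((α i = L ∧ α (i + 1) = R) ∨ (α i = R ∧ α (i + 1) = L)) ∧
    β = fun j => if j < i then α j else α (j + 2)

/-- `α` is a, possibly not reduced, code of `μ`: finitely many cancellations of `LR` and `RL` turn
it into the code of `μ`. -/
def IsCodeOf (α : ℤ → Letter) (μ : List ℤ) : Prop := Relation.ReflTransGen Cancel α (code μ)

/-- `α ∼ ε β` for a sign `ε`: the codes `α` of `μ` and `β` of `ν` satisfy `B_μ = ε B_ν`. -/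
def CodeRel (α : ℤ → Letter) (ε : ℤˣ) (β : ℤ → Letter) : Prop :=
  ∃ μ ν : List ℤ, IsCodeOf α μ ∧ IsCodeOf β ν ∧ BComp μ = (ε : ℤ) • BComp ν

/-- `α ∼ 0`: the code `α` of `μ` satisfies `B_μ = 0`. -/
def CodeRelZero (α : ℤ → Letter) : Prop := ∃ μ : List ℤ, IsCodeOf α μ ∧ BComp μ = 0

/-- `α₁ ∼ ε β₁` for finite words: replacing the subword `α₁` by `β₁` in any code
`α₀ α₁ α₂`, where `α₀ = …UUU a` and `α₂ = c RRR…`, gives a related code. -/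
def WordRel (α₁ : List Letter) (ε : ℤˣ) (β₁ : List Letter) : Prop :=
  ∀ a c : List Letter, CodeRel (extend (a ++ α₁ ++ c)) ε (extend (a ++ β₁ ++ c))

/-- `α₁ ∼ 0` for a finite word: every code `α₀ α₁ α₂` containing the subword `α₁` satisfies
`α₀ α₁ α₂ ∼ 0`. -/
def WordRelZero (α₁ : List Letter) : Prop :=
  ∀ a c : List Letter, CodeRelZero (extend (a ++ α₁ ++ c))

end Bernstein

end

namespace Bernstein

open Letter

/-! ## Every word is a code -/

/-! Deleting `LR` or `RL` changes neither the abscissas of the up steps nor their order. Hence every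
word is a code of the composition formed by the abscissas of its `U`s (`isCodeOf_extend`), and each
relation becomes an identity between products of Bernstein operators.

If the replaced subword starts at abscissa `x`, both sides of the first relation have their only `U`
at `x + 1 - k` and end at `x`, so the compositions coincide. The second relation amounts to `B (x -
k) * B x = -(B (x - 1) * B (x - k + 1))`, and `ULU` gives `B (x - 1) * B x = 0`. Both are cases of
`B_mul_B`.

For `B_mul_B`, moving the annihilation part of B(s) past the creation part of B(t) costs a factor 1
- t/s (`annihilationZ_mul_creationZ`), so B(s)B(t) = (1 - t/s) :B(s)B(t):. The normally ordered
product is symmetric in s and t, which gives the sign. The factor is obtained coefficientwise, by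
induction along the recursion that comes from t d/dt exp F = (t dF/dt) exp F. -/

/-- The horizontal positions, from bottom to top, of the up steps of a path starting at `x`. -/
def upSteps : ℤ → List Letter → List ℤ
  | _, [] => []
  | x, R :: w => upSteps (x + 1) w
  | x, L :: w => upSteps (x - 1) w
  | x, U :: w => x :: upSteps x w

/-- The horizontal position of the end point of a path starting at `x`. -/
def endPos : ℤ → List Letter → ℤ
  | x, [] => x
  | x, R :: w => endPos (x + 1) w
  | x, L :: w => endPos (x - 1) w
  | x, U :: w => endPos x w

theorem upSteps_append (x : ℤ) (v w : List Letter) :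
    upSteps x (v ++ w) = upSteps x v ++ upSteps (endPos x v) w := by
  induction v generalizing x with
  | nil => rfl
  | cons l v ih => cases l <;> simp [upSteps, endPos, ih]

theorem endPos_append (x : ℤ) (v w : List Letter) :
    endPos x (v ++ w) = endPos (endPos x v) w := by
  induction v generalizing x with
  | nil => rfl
  | cons l v ih => cases l <;> simp [endPos, ih]

theorem upSteps_replicate_R (x : ℤ) (n : ℕ) : upSteps x (List.replicate n R) = [] := by
  induction n generalizing x with
  | zero => rfl
  | succ n ih => simpa [List.replicate_succ, upSteps] using ih _

theorem upSteps_replicate_L (x : ℤ) (n : ℕ) : upSteps x (List.replicate n L) = [] := by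
  induction n generalizing x with
  | zero => rfl
  | succ n ih => simpa [List.replicate_succ, upSteps] using ih _

theorem endPos_replicate_R (x : ℤ) (n : ℕ) : endPos x (List.replicate n R) = x + n := by
  induction n generalizing x with
  | zero => simp [endPos]
  | succ n ih => simp only [List.replicate_succ, endPos, ih]; push_cast; ring

theorem endPos_replicate_L (x : ℤ) (n : ℕ) : endPos x (List.replicate n L) = x - n := by
  induction n generalizing x with
  | zero => simp [endPos]
  | succ n ih => simp only [List.replicate_succ, endPos, ih]; push_cast; ring

theorem upSteps_Rpow (x n : ℤ) : upSteps x (Rpow n) = [] := by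
  simp [Rpow, upSteps_append, upSteps_replicate_R, upSteps_replicate_L]

theorem endPos_Rpow (x n : ℤ) : endPos x (Rpow n) = x + n := by
  simp only [Rpow, endPos_append, endPos_replicate_R, endPos_replicate_L]
  omega

theorem extend_natCast (w : List Letter) (n : ℕ) : extend w n = w.getD n R := by
  simp [extend]

theorem extend_append_R (w : List Letter) : extend (w ++ [R]) = extend w := by
  funext i
  rcases lt_or_ge i 0 with hi | hi
  · simp [extend, hi]
  · lift i to ℕ using hi
    rw [extend_natCast, extend_natCast]
    rcases lt_trichotomy i w.length with h | h | h
    · rw [List.getD_append _ _ _ _ h]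
    · rw [List.getD_append_right _ _ _ _ h.ge, List.getD_eq_default w _ h.ge]; simp [h]
    · rw [List.getD_eq_default, List.getD_eq_default w _ h.le]; simp; omega

theorem cancel_extend (v w : List Letter) {l l' : Letter}
    (h : (l = L ∧ l' = R) ∨ (l = R ∧ l' = L)) :
    Cancel (extend (v ++ l :: l' :: w)) (extend (v ++ w)) := by
  refine ⟨v.length, by positivity, ?_, ?_⟩
  · have h0 : extend (v ++ l :: l' :: w) v.length = l := by
      rw [extend_natCast, List.getD_append_right _ _ _ _ le_rfl]; simp
    have h1 : extend (v ++ l :: l' :: w) (v.length + 1) = l' := by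
      have := extend_natCast (v ++ l :: l' :: w) (v.length + 1)
      rw [List.getD_append_right _ _ _ _ (by omega)] at this
      simpa using this
    rwa [h0, h1]
  · funext j
    rcases lt_or_ge j 0 with hj | hj
    · have : j < v.length := by omega
      simp [extend, hj, this]
    · lift j to ℕ using hj
      rw [extend_natCast]
      split_ifs with hjv
      · have hjv : j < v.length := by exact_mod_cast hjv
        rw [extend_natCast, List.getD_append _ _ _ _ hjv, List.getD_append _ _ _ _ hjv]
      · have hjv : v.length ≤ j := by exact_mod_cast not_lt.mp hjv
        have := extend_natCast (v ++ l :: l' :: w) (j + 2)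
        rw [List.getD_append_right _ _ _ _ (by omega)] at this
        push_cast at this
        rw [this, List.getD_append_right _ _ _ _ hjv,
          show j + 2 - v.length = (j - v.length) + 2 by omega]
        simp

/-! ### Reduction of an arbitrary word to an edge word -/

theorem Rpow_zero : Rpow 0 = [] := rfl

theorem Rpow_succ {n : ℤ} (hn : 0 ≤ n) : Rpow (n + 1) = R :: Rpow n := by
  lift n to ℕ using hn
  simp only [Rpow, show ((n : ℤ) + 1).toNat = n + 1 by omega,
    show (-((n : ℤ) + 1)).toNat = 0 by omega, show (-(n : ℤ)).toNat = 0 by omega, Int.toNat_natCast,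
    List.replicate_succ, List.cons_append]

theorem Rpow_pred {n : ℤ} (hn : n ≤ 0) : Rpow (n - 1) = L :: Rpow n := by
  obtain ⟨k, rfl⟩ : ∃ k : ℕ, n = -(k : ℤ) := ⟨n.natAbs, by omega⟩
  simp only [Rpow, show (-(k : ℤ) - 1).toNat = 0 by omega, show (-(k : ℤ)).toNat = 0 by omega,
    show (-(-(k : ℤ) - 1)).toNat = k + 1 by omega, show (- -(k : ℤ)).toNat = k by omega,
    List.replicate_succ, List.replicate_zero, List.nil_append]

/-- `v` can be reduced to `w` by cancellations after any initial word. -/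
def Reduces (v w : List Letter) : Prop :=
  ∀ u : List Letter, Relation.ReflTransGen Cancel (extend (u ++ v)) (extend (u ++ w))

theorem Reduces.trans {u v w : List Letter} (h : Reduces u v) (h' : Reduces v w) : Reduces u w :=
  fun a => (h a).trans (h' a)

theorem Reduces.cons {v w : List Letter} (h : Reduces v w) (l : Letter) :
    Reduces (l :: v) (l :: w) := fun a => by simpa using h (a ++ [l])

theorem reduces_cancel {l l' : Letter} (h : (l = L ∧ l' = R) ∨ (l = R ∧ l' = L))
    (w : List Letter) : Reduces (l :: l' :: w) w :=
  fun a => .single (cancel_extend a w h)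

theorem reduces_refl (w : List Letter) : Reduces w w := fun _ => .refl

/-- The leading `R` lengthens a run of `R`s, cancels the first `L`, or, when no rows are left,
merges into the infinite ray of `R`s. -/
theorem reduces_R_edgeWord (x : ℤ) (rows : List ℤ) :
    Reduces (R :: edgeWord (x + 1) rows) (edgeWord x rows) := by
  cases rows with
  | nil => intro a; simp only [edgeWord, List.append_nil, extend_append_R]; rfl
  | cons m rows =>
    simp only [edgeWord]
    rcases le_or_gt 0 (m - (x + 1)) with h | h
    · rw [show m - x = m - (x + 1) + 1 by ring, Rpow_succ h]; exact reduces_refl _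
    · rw [show m - (x + 1) = m - x - 1 by ring, Rpow_pred (by omega)]
      exact reduces_cancel (.inr ⟨rfl, rfl⟩) _

theorem reduces_L_edgeWord (x : ℤ) (rows : List ℤ) :
    Reduces (L :: edgeWord (x - 1) rows) (edgeWord x rows) := by
  cases rows with
  | nil =>
    intro a
    simp only [edgeWord]
    -- With no rows left, an `R` is borrowed from the infinite ray to cancel the `L`.
    rw [← extend_append_R, List.append_assoc]
    exact reduces_cancel (.inl ⟨rfl, rfl⟩) [] a
  | cons m rows =>
    simp only [edgeWord]
    rcases le_or_gt (m - (x - 1)) 0 with h | h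
    · rw [show m - x = m - (x - 1) - 1 by ring, Rpow_pred h]; exact reduces_refl _
    · rw [show m - (x - 1) = m - x + 1 by ring, Rpow_succ (by omega)]
      exact reduces_cancel (.inl ⟨rfl, rfl⟩) _

theorem reduces_edgeWord (x : ℤ) (w : List Letter) : Reduces w (edgeWord x (upSteps x w)) := by
  induction w generalizing x with
  | nil => exact reduces_refl _
  | cons l w ih =>
    cases l with
    | R => exact ((ih (x + 1)).cons R).trans (reduces_R_edgeWord x _)
    | L => exact ((ih (x - 1)).cons L).trans (reduces_L_edgeWord x _)
    | U =>
      simp only [upSteps, edgeWord, sub_self, Rpow_zero, List.nil_append]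
      exact (ih x).cons U

/-- The reversal is needed because a path meets its up steps from bottom to top, while parts are
listed from top to bottom. -/
theorem isCodeOf_extend (w : List Letter) : IsCodeOf (extend w) (upSteps 0 w).reverse := by
  have := reduces_edgeWord 0 w []
  simpa [IsCodeOf, code] using this

end Bernstein

noncomputable section
namespace Bernstein

/-! ## Recursion for the exponential -/

theorem coeff_pow_eq_zero {F : OpSeries} (hF : PowerSeries.coeff 0 F = 0) {n j : ℕ} (h : n < j) :
    PowerSeries.coeff n (F ^ j) = 0 := by
  induction j generalizing n with
  | zero => omega
  | succ j ih =>
    rw [pow_succ, PowerSeries.coeff_mul]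
    refine Finset.sum_eq_zero fun p hp => ?_
    rw [Finset.HasAntidiagonal.mem_antidiagonal] at hp
    rcases Nat.eq_zero_or_pos p.2 with h2 | h2
    · rw [h2, hF, mul_zero]
    · rw [ih (by omega), zero_mul]

/-- The Euler operator `t d/dt`. -/
def euler (F : OpSeries) : OpSeries :=
  PowerSeries.mk fun n => (n : ℂ) • PowerSeries.coeff n F

theorem coeff_euler (F : OpSeries) (n : ℕ) :
    PowerSeries.coeff n (euler F) = (n : ℂ) • PowerSeries.coeff n F :=
  PowerSeries.coeff_mk _ _

theorem euler_mul (F G : OpSeries) : euler (F * G) = euler F * G + F * euler G := by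
  ext1 n
  simp only [map_add, coeff_euler, PowerSeries.coeff_mul, Finset.smul_sum,
    ← Finset.sum_add_distrib]
  refine Finset.sum_congr rfl fun p hp => ?_
  rw [← Finset.HasAntidiagonal.mem_antidiagonal.mp hp]
  simp only [Nat.cast_add, add_smul, smul_mul_assoc, mul_smul_comm]

theorem commute_euler {F : OpSeries}
    (hF : ∀ i j, Commute (PowerSeries.coeff i F) (PowerSeries.coeff j F)) :
    Commute F (euler F) := by
  rw [commute_iff_eq]
  ext1 n
  rw [PowerSeries.coeff_mul, PowerSeries.coeff_mul, ← Finset.Nat.sum_antidiagonal_swap]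
  refine Finset.sum_congr rfl fun p _ => ?_
  simp only [coeff_euler, Prod.fst_swap, Prod.snd_swap, smul_mul_assoc, mul_smul_comm]
  rw [(hF p.2 p.1).eq]

/-- The coefficients are operators, so the power rule needs `F` to commute with its own derivative.
-/
theorem euler_pow_succ {F : OpSeries}
    (hF : ∀ i j, Commute (PowerSeries.coeff i F) (PowerSeries.coeff j F)) (j : ℕ) :
    euler (F ^ (j + 1)) = ((j + 1 : ℕ) : ℂ) • (euler F * F ^ j) := by
  induction j with
  | zero => simp
  | succ j ih =>
    rw [pow_succ, euler_mul, ih, ((commute_euler hF).pow_left (j + 1)).eq, smul_mul_assoc,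
      mul_assoc, ← pow_succ, Nat.cast_succ (j + 1), add_smul, one_smul]

theorem coeff_zero_expSeries (F : OpSeries) : PowerSeries.coeff 0 (expSeries F) = 1 := by
  simp [expSeries]

theorem coeff_expSeries {F : OpSeries} (h0 : PowerSeries.coeff 0 F = 0) {n K : ℕ} (h : n < K) :
    PowerSeries.coeff n (expSeries F) =
      ∑ j ∈ Finset.range K, ((j.factorial : ℂ)⁻¹) • PowerSeries.coeff n (F ^ j) := by
  rw [expSeries, PowerSeries.coeff_mk]
  refine Finset.sum_subset (Finset.range_mono h) fun j _ hj => ?_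
  rw [coeff_pow_eq_zero h0 (by simpa using hj), smul_zero]

theorem smul_coeff_expSeries {F : OpSeries} (h0 : PowerSeries.coeff 0 F = 0)
    (hF : ∀ i j, Commute (PowerSeries.coeff i F) (PowerSeries.coeff j F)) (n : ℕ) :
    (n : ℂ) • PowerSeries.coeff n (expSeries F) = ∑ p ∈ Finset.HasAntidiagonal.antidiagonal n,
      PowerSeries.coeff p.1 (euler F) * PowerSeries.coeff p.2 (expSeries F) := by
  -- One superfluous term is included, so that splitting off `j = 0` and lowering the exponent
  -- leaves the range `n + 1`.
  rw [coeff_expSeries h0 (show n < n + 1 + 1 by omega), Finset.sum_range_succ', smul_add,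
    Finset.smul_sum]
  have hz : (n : ℂ) • (((0).factorial : ℂ)⁻¹) • PowerSeries.coeff n (F ^ 0) = 0 := by
    rcases Nat.eq_zero_or_pos n with rfl | hn
    · simp
    · simp [PowerSeries.coeff_one, hn.ne']
  rw [hz, add_zero]
  have hterm : ∀ j ∈ Finset.range (n + 1),
      (n : ℂ) • ((((j + 1).factorial : ℕ) : ℂ)⁻¹) • PowerSeries.coeff n (F ^ (j + 1)) =
        ∑ p ∈ Finset.HasAntidiagonal.antidiagonal n, ((j.factorial : ℂ)⁻¹) •
          (PowerSeries.coeff p.1 (euler F) * PowerSeries.coeff p.2 (F ^ j)) := fun j _ => by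
    rw [smul_comm, ← coeff_euler, euler_pow_succ hF, PowerSeries.coeff_smul, smul_smul,
      PowerSeries.coeff_mul, Finset.smul_sum]
    have : (((j + 1).factorial : ℕ) : ℂ)⁻¹ * ((j + 1 : ℕ) : ℂ) = (j.factorial : ℂ)⁻¹ := by
      have : ((j + 1 : ℕ) : ℂ) ≠ 0 := Nat.cast_ne_zero.mpr j.succ_ne_zero
      rw [Nat.factorial_succ, Nat.cast_mul, mul_inv, mul_right_comm, inv_mul_cancel₀ this, one_mul]
    rw [this]
  rw [Finset.sum_congr rfl hterm, Finset.sum_comm]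
  refine Finset.sum_congr rfl fun p hp => ?_
  rw [coeff_expSeries h0 (show p.2 < n + 1 by have := Finset.HasAntidiagonal.mem_antidiagonal.mp hp; omega),
    Finset.mul_sum]
  exact Finset.sum_congr rfl fun j _ => (mul_smul_comm _ _ _).symm

/-- The coefficients of `expSeries F`, extended by zero to negative indices. -/
def expCoeff (F : OpSeries) (a : ℤ) : Module.End ℂ Sym :=
  if 0 ≤ a then PowerSeries.coeff a.toNat (expSeries F) else 0

theorem expCoeff_of_neg (F : OpSeries) {a : ℤ} (h : a < 0) : expCoeff F a = 0 :=
  if_neg (not_le.mpr h)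

theorem expCoeff_natCast (F : OpSeries) (n : ℕ) :
    expCoeff F n = PowerSeries.coeff n (expSeries F) := by
  simp [expCoeff]

theorem expCoeff_zero (F : OpSeries) : expCoeff F 0 = 1 := by
  simp [expCoeff, coeff_zero_expSeries]

/-- The free bound `K` allows recursions for different indices to be summed over the same range. -/
theorem smul_expCoeff {F : OpSeries} (h0 : PowerSeries.coeff 0 F = 0)
    (hF : ∀ i j, Commute (PowerSeries.coeff i F) (PowerSeries.coeff j F))
    (a : ℤ) {K : ℕ} (hK : a ≤ K) :
    (a : ℂ) • expCoeff F a = ∑ k ∈ Finset.range K,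
      PowerSeries.coeff (k + 1) (euler F) * expCoeff F (a - 1 - k) := by
  rcases lt_or_ge a 0 with ha | ha
  · rw [expCoeff_of_neg F ha, smul_zero]
    exact (Finset.sum_eq_zero fun k _ => by
      rw [expCoeff_of_neg F (by omega), mul_zero]).symm
  lift a to ℕ using ha
  rw [expCoeff_natCast, Int.cast_natCast, smul_coeff_expSeries h0 hF]
  rw [Finset.Nat.sum_antidiagonal_eq_sum_range_succ
    (fun i j => PowerSeries.coeff i (euler F) * PowerSeries.coeff j (expSeries F)),
    Finset.sum_range_succ', coeff_euler F 0, Nat.cast_zero, zero_smul, zero_mul, add_zero]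
  have hK' : a ≤ K := by exact_mod_cast hK
  rw [← Finset.sum_subset (Finset.range_mono hK') fun k _ hk => ?_]
  · refine Finset.sum_congr rfl fun k hk => ?_
    have := Finset.mem_range.mp hk
    rw [← expCoeff_natCast, show ((a - (k + 1) : ℕ) : ℤ) = a - 1 - k by omega]
  · rw [Finset.mem_range] at hk
    rw [expCoeff_of_neg F (by omega), mul_zero]

theorem commute_expCoeff {F : OpSeries} {x : Module.End ℂ Sym}
    (hx : ∀ i, Commute x (PowerSeries.coeff i F)) (a : ℤ) : Commute x (expCoeff F a) := by
  have hpow : ∀ j i, Commute x (PowerSeries.coeff i (F ^ j)) := fun j => by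
    induction j with
    | zero =>
      intro i
      rw [pow_zero, PowerSeries.coeff_one]
      split_ifs
      exacts [Commute.one_right x, Commute.zero_right x]
    | succ j ih =>
      intro i
      rw [pow_succ, PowerSeries.coeff_mul]
      exact Commute.sum_right _ _ _ fun p _ => (ih p.1).mul_right (hx p.2)
  unfold expCoeff
  split_ifs
  · rw [expSeries, PowerSeries.coeff_mk]
    exact Commute.sum_right _ _ _ fun j _ => (hpow j _).smul_right _
  · exact Commute.zero_right x

theorem commute_expCoeff_expCoeff {F : OpSeries}
    (hF : ∀ i j, Commute (PowerSeries.coeff i F) (PowerSeries.coeff j F)) (a b : ℤ) :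
    Commute (expCoeff F a) (expCoeff F b) :=
  commute_expCoeff (fun i => (commute_expCoeff (fun j => hF i j) a).symm) b

theorem end_neg_mul (x y : Module.End ℂ Sym) : -x * y = -(x * y) := rfl

theorem end_mul_neg (x y : Module.End ℂ Sym) : x * -y = -(x * y) :=
  LinearMap.ext fun f => map_neg x (y f)

theorem end_sub_one_smul (c : ℂ) (x : Module.End ℂ Sym) : (c - 1) • x = c • x - x :=
  LinearMap.ext fun f => (sub_smul c 1 (x f)).trans (congrArg _ (one_smul ℂ (x f)))

/-! ## Commutation of creation and annihilation -/

/-- Multiplication by the power sum `p_{k+1}`. -/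
def mulP (k : ℕ) : Module.End ℂ Sym := LinearMap.mulLeft ℂ (MvPolynomial.X k.succPNat : Sym)

/-- The partial derivative with respect to the power sum `p_{k+1}`. -/
def derivP (k : ℕ) : Module.End ℂ Sym :=
  ((MvPolynomial.pderiv k.succPNat : Derivation ℂ Sym Sym) : Sym →ₗ[ℂ] Sym)

theorem derivP_mul_mulP (i j : ℕ) :
    derivP i * mulP j = mulP j * derivP i + if i = j then 1 else 0 := by
  refine LinearMap.ext fun f => ?_
  have h : (derivP i * mulP j) f = MvPolynomial.X j.succPNat * derivP i f +
      f * (Pi.single i.succPNat 1 : ℕ+ → Sym) j.succPNat := by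
    rw [← MvPolynomial.pderiv_X (R := ℂ)]
    exact Derivation.leibniz (MvPolynomial.pderiv i.succPNat : Derivation ℂ Sym Sym)
      (MvPolynomial.X j.succPNat) f
  rw [h, Pi.single_apply]
  by_cases hij : i = j
  · subst hij; simp [mulP]
  · have : ¬ j.succPNat = i.succPNat := fun h => hij (Nat.succPNat_injective h).symm
    simp [mulP, hij, this]

/-- The commutator is again a derivation, and it kills every variable. -/
theorem derivP_commute (i j : ℕ) : Commute (derivP i) (derivP j) := by
  refine LinearMap.ext fun f => ?_
  have h : ⁅(MvPolynomial.pderiv i.succPNat : Derivation ℂ Sym Sym),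
      (MvPolynomial.pderiv j.succPNat : Derivation ℂ Sym Sym)⁆ = 0 := by
    refine MvPolynomial.derivation_ext fun k => ?_
    rw [Derivation.commutator_apply, MvPolynomial.pderiv_X, MvPolynomial.pderiv_X,
      Pi.single_apply, Pi.single_apply]
    split_ifs <;> simp
  have := congrArg (fun D : Derivation ℂ Sym Sym => D f) h
  rw [Derivation.commutator_apply] at this
  exact sub_eq_zero.mp this

theorem mulP_commute (i j : ℕ) : Commute (mulP i) (mulP j) :=
  LinearMap.ext fun f => by
    simp only [mulP, Module.End.mul_apply, LinearMap.mulLeft_apply]; ring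

theorem coeff_zero_creationExponent : PowerSeries.coeff 0 creationExponent = 0 := by
  simp [creationExponent]

theorem coeff_zero_annihilationExponent : PowerSeries.coeff 0 annihilationExponent = 0 := by
  simp [annihilationExponent]

theorem coeff_succ_creationExponent (k : ℕ) :
    PowerSeries.coeff (k + 1) creationExponent = (((k + 1 : ℕ) : ℂ)⁻¹) • mulP k := by
  rw [creationExponent, PowerSeries.coeff_mk, dif_pos k.succ_pos]
  rfl

theorem coeff_succ_annihilationExponent (k : ℕ) :
    PowerSeries.coeff (k + 1) annihilationExponent = -derivP k := by
  rw [annihilationExponent, PowerSeries.coeff_mk, dif_pos k.succ_pos]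
  rfl

theorem creationExponent_commute (i j : ℕ) : Commute (PowerSeries.coeff i creationExponent)
    (PowerSeries.coeff j creationExponent) := by
  cases i with
  | zero => rw [coeff_zero_creationExponent]; exact Commute.zero_left _
  | succ i =>
    cases j with
    | zero => rw [coeff_zero_creationExponent]; exact Commute.zero_right _
    | succ j =>
      rw [coeff_succ_creationExponent, coeff_succ_creationExponent]
      exact ((mulP_commute i j).smul_left _).smul_right _

theorem annihilationExponent_commute (i j : ℕ) :
    Commute (PowerSeries.coeff i annihilationExponent)
      (PowerSeries.coeff j annihilationExponent) := by
  cases i with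
  | zero => rw [coeff_zero_annihilationExponent]; exact Commute.zero_left _
  | succ i =>
    cases j with
    | zero => rw [coeff_zero_annihilationExponent]; exact Commute.zero_right _
    | succ j =>
      rw [coeff_succ_annihilationExponent, coeff_succ_annihilationExponent]
      exact (derivP_commute i j).neg_left.neg_right

/-- The operators `creation a`, extended by zero to `a < 0`. -/
def creationZ : ℤ → Module.End ℂ Sym := expCoeff creationExponent

/-- The operators `annihilation b`, extended by zero to `b < 0`. -/
def annihilationZ : ℤ → Module.End ℂ Sym := expCoeff annihilationExponent

theorem creationZ_of_neg {a : ℤ} (h : a < 0) : creationZ a = 0 := expCoeff_of_neg _ h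

theorem annihilationZ_of_neg {b : ℤ} (h : b < 0) : annihilationZ b = 0 := expCoeff_of_neg _ h

theorem creationZ_zero : creationZ 0 = 1 := expCoeff_zero _

theorem annihilationZ_zero : annihilationZ 0 = 1 := expCoeff_zero _

theorem annihilationZ_natCast (b : ℕ) : annihilationZ b = annihilation b := expCoeff_natCast _ b

theorem creationZ_commute (a b : ℤ) : Commute (creationZ a) (creationZ b) :=
  commute_expCoeff_expCoeff creationExponent_commute a b

theorem annihilationZ_commute (a b : ℤ) : Commute (annihilationZ a) (annihilationZ b) :=
  commute_expCoeff_expCoeff annihilationExponent_commute a b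

/-- Newton's identity a h_a = ∑ p_k h_{a-k}: the Euler operator cancels the denominators 1/k. -/
theorem smul_creationZ (a : ℤ) {K : ℕ} (hK : a ≤ K) :
    (a : ℂ) • creationZ a = ∑ k ∈ Finset.range K, mulP k * creationZ (a - 1 - k) := by
  refine (smul_expCoeff coeff_zero_creationExponent creationExponent_commute a hK).trans ?_
  refine Finset.sum_congr rfl fun k _ => ?_
  rw [coeff_euler, coeff_succ_creationExponent, smul_smul,
    mul_inv_cancel₀ (Nat.cast_ne_zero.mpr k.succ_ne_zero), one_smul]
  rfl

theorem smul_annihilationZ (b : ℤ) {K : ℕ} (hK : b ≤ K) :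
    (b : ℂ) • annihilationZ b =
      -∑ k ∈ Finset.range K, ((k + 1 : ℕ) : ℂ) • (derivP k * annihilationZ (b - 1 - k)) := by
  refine (smul_expCoeff coeff_zero_annihilationExponent annihilationExponent_commute b hK).trans ?_
  rw [← Finset.sum_neg_distrib]
  refine Finset.sum_congr rfl fun k _ => ?_
  rw [coeff_euler, coeff_succ_annihilationExponent, smul_neg, ← smul_mul_assoc]
  exact end_neg_mul _ _

/-- This is k ∂h_a/∂p_k = h_{a-k} with `k` shifted by one, proved by strong induction on `a` through
Newton's identity. -/
theorem derivP_mul_creationZ (k : ℕ) (a : ℤ) :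
    ((k + 1 : ℕ) : ℂ) • (derivP k * creationZ a) =
      ((k + 1 : ℕ) : ℂ) • (creationZ a * derivP k) + creationZ (a - 1 - k) := by
  suffices H : ∀ n : ℕ, ∀ a : ℤ, a < n → ((k + 1 : ℕ) : ℂ) • (derivP k * creationZ a) =
      ((k + 1 : ℕ) : ℂ) • (creationZ a * derivP k) + creationZ (a - 1 - k) from
    H (a.toNat + 1) a (by omega)
  intro n
  induction n with
  | zero =>
    intro a ha
    rw [creationZ_of_neg (show a < 0 by omega), creationZ_of_neg (show a - 1 - k < 0 by omega)]
    simp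
  | succ n ih =>
    intro a ha
    rcases lt_trichotomy a 0 with h | rfl | h
    · exact ih a (by omega)
    · rw [creationZ_zero, creationZ_of_neg (show (0 : ℤ) - 1 - k < 0 by omega)]
      simp
    -- This bound serves the recursions at `a` and at `a - 1 - k`, and makes the diagonal index `k`
    -- occur in the sum.
    have hK : a ≤ ((a.toNat + k + 1 : ℕ) : ℤ) := by omega
    have hK' : a - 1 - k ≤ ((a.toNat + k + 1 : ℕ) : ℤ) := by omega
    have hk : k ∈ Finset.range (a.toNat + k + 1) := by simp
    have h1 := smul_creationZ a hK
    have h2 := smul_creationZ (a - 1 - k) hK'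
    set K := a.toNat + k + 1
    have ha0 : (a : ℂ) ≠ 0 := by exact_mod_cast h.ne'
    refine smul_right_injective _ ha0 ?_
    simp only
    have hl : (a : ℂ) • ((k + 1 : ℕ) : ℂ) • (derivP k * creationZ a) =
        ∑ j ∈ Finset.range K, ((k + 1 : ℕ) : ℂ) • (derivP k * (mulP j * creationZ (a - 1 - j))) := by
      rw [smul_comm, ← mul_smul_comm, h1, Finset.mul_sum, Finset.smul_sum]
    have hr : (a : ℂ) • ((k + 1 : ℕ) : ℂ) • (creationZ a * derivP k) =
        ∑ j ∈ Finset.range K, ((k + 1 : ℕ) : ℂ) • (mulP j * creationZ (a - 1 - j) * derivP k) := by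
      rw [smul_comm, ← smul_mul_assoc, h1, Finset.sum_mul, Finset.smul_sum]
    have hterm : ∀ j ∈ Finset.range K,
        ((k + 1 : ℕ) : ℂ) • (derivP k * (mulP j * creationZ (a - 1 - j))) =
          ((k + 1 : ℕ) : ℂ) • (mulP j * creationZ (a - 1 - j) * derivP k) +
          mulP j * creationZ (a - 1 - k - 1 - j) +
          if k = j then ((k + 1 : ℕ) : ℂ) • creationZ (a - 1 - k) else 0 := fun j _ => by
      have e := ih (a - 1 - j) (by omega)
      rw [← mul_assoc, derivP_mul_mulP, add_mul, smul_add, mul_assoc, ← mul_smul_comm, e, mul_add,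
        mul_smul_comm, ← mul_assoc, show a - 1 - j - 1 - k = a - 1 - k - 1 - j by ring]
      congr 1
      split_ifs with hkj
      · rw [one_mul, hkj]
      · rw [zero_mul, smul_zero]
    -- The coefficient `a - 1 - k` from Newton's identity and `k + 1` from the diagonal term add up
    -- to `a`.
    rw [smul_add, hl, hr, Finset.sum_congr rfl hterm, Finset.sum_add_distrib,
      Finset.sum_add_distrib, ← h2, Finset.sum_ite_eq, if_pos hk, add_assoc, ← add_smul]
    congr 2
    push_cast; ring

/-- Coefficient form of E(u)H(t) = (1 - tu)H(t)E(u), for the creation series H and the annihilation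
series E. In the induction on `b`, the terms that arise when the derivatives pass the creation
operators telescope. -/
theorem annihilationZ_mul_creationZ (b a : ℤ) :
    annihilationZ b * creationZ a =
      creationZ a * annihilationZ b - creationZ (a - 1) * annihilationZ (b - 1) := by
  suffices H : ∀ n : ℕ, ∀ b : ℤ, b < n → ∀ a : ℤ, annihilationZ b * creationZ a =
      creationZ a * annihilationZ b - creationZ (a - 1) * annihilationZ (b - 1) from
    H (b.toNat + 1) b (by omega) a
  clear a b
  intro n
  induction n with
  | zero =>
    intro b hb a
    rw [annihilationZ_of_neg (show b < 0 by omega),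
      annihilationZ_of_neg (show b - 1 < 0 by omega)]
    simp
  | succ n ih =>
    intro b hb a
    rcases lt_trichotomy b 0 with h | rfl | h
    · exact ih b (by omega) a
    · rw [annihilationZ_zero, annihilationZ_of_neg (show (0 : ℤ) - 1 < 0 by omega)]
      simp
    have hK : b ≤ ((b.toNat + 1 : ℕ) : ℤ) := by omega
    have hK' : b - 1 ≤ ((b.toNat + 1 : ℕ) : ℤ) := by omega
    have hKb : b - 1 - ((b.toNat + 1 : ℕ) : ℤ) < 0 := by omega
    have h1 := smul_annihilationZ b hK
    have h2 := smul_annihilationZ (b - 1) hK'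
    set K := b.toNat + 1
    have hb0 : (b : ℂ) ≠ 0 := by exact_mod_cast h.ne'
    refine smul_right_injective _ hb0 ?_
    simp only
    have hterm : ∀ k ∈ Finset.range K,
        ((k + 1 : ℕ) : ℂ) • (derivP k * annihilationZ (b - 1 - k)) * creationZ a =
          creationZ a * (((k + 1 : ℕ) : ℂ) • (derivP k * annihilationZ (b - 1 - k))) -
          creationZ (a - 1) * (((k + 1 : ℕ) : ℂ) • (derivP k * annihilationZ (b - 1 - 1 - k))) +
          (creationZ (a - 1 - k) * annihilationZ (b - 1 - k) -
            creationZ (a - 1 - (k + 1 : ℕ)) * annihilationZ (b - 1 - (k + 1 : ℕ))) :=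
        fun k _ => by
      have e := ih (b - 1 - k) (by omega) a
      have e1 := derivP_mul_creationZ k a
      have e2 := derivP_mul_creationZ k (a - 1)
      rw [smul_mul_assoc, mul_assoc, e, mul_sub, smul_sub, ← mul_assoc, ← mul_assoc,
        ← smul_mul_assoc _ (derivP k * creationZ a),
        ← smul_mul_assoc _ (derivP k * creationZ (a - 1)), e1, e2, mul_smul_comm, mul_smul_comm,
        add_mul, add_mul, smul_mul_assoc, smul_mul_assoc, mul_assoc, mul_assoc,
        show a - 1 - 1 - k = a - 1 - ((k + 1 : ℕ) : ℤ) by push_cast; ring,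
        show b - 1 - k - 1 = b - 1 - ((k + 1 : ℕ) : ℤ) by push_cast; ring,
        show b - 1 - 1 - k = b - 1 - ((k + 1 : ℕ) : ℤ) by push_cast; ring]
      abel
    -- The upper end vanishes because its annihilation index is negative; the surviving lower end
    -- raises the coefficient `b - 1` to `b`, which is then divided out.
    have htel := Finset.sum_range_sub'
      (fun k : ℕ => creationZ (a - 1 - k) * annihilationZ (b - 1 - k)) K
    rw [annihilationZ_of_neg hKb, mul_zero, sub_zero, Nat.cast_zero, sub_zero,
      sub_zero] at htel
    have e1 : creationZ a * ∑ k ∈ Finset.range K,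
        (((k + 1 : ℕ) : ℂ) • (derivP k * annihilationZ (b - 1 - k))) =
        -((b : ℂ) • (creationZ a * annihilationZ b)) := by
      rw [← mul_smul_comm, h1, end_mul_neg, neg_neg]
    have e2 : creationZ (a - 1) * ∑ k ∈ Finset.range K,
        (((k + 1 : ℕ) : ℂ) • (derivP k * annihilationZ (b - 1 - 1 - k))) =
        -(((b - 1 : ℤ) : ℂ) • (creationZ (a - 1) * annihilationZ (b - 1))) := by
      rw [← mul_smul_comm, h2, end_mul_neg, neg_neg]
    rw [← smul_mul_assoc, h1, end_neg_mul, Finset.sum_mul, Finset.sum_congr rfl hterm,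
      Finset.sum_add_distrib, Finset.sum_sub_distrib, ← Finset.mul_sum, ← Finset.mul_sum, htel,
      e1, e2, smul_sub]
    push_cast
    rw [end_sub_one_smul]
    abel

/-! ## The Bernstein relation -/

theorem B_apply_eq_sum (n : ℤ) {f : Sym} {K : ℕ} (hf : ∀ b : ℕ, K ≤ b → annihilationZ b f = 0) :
    B n f = ∑ b ∈ Finset.range K, creationZ (n + b) (annihilationZ b f) := by
  have hterm : ∀ b : ℕ, bernsteinTerm n b f = creationZ (n + b) (annihilationZ b f) := fun b => by
    rw [annihilationZ_natCast]
    unfold bernsteinTerm creationZ expCoeff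
    split_ifs <;> rfl
  change ∑ᶠ b : ℕ, bernsteinTerm n b f = _
  rw [finsum_congr hterm]
  refine finsum_eq_sum_of_support_subset _ fun b hb => ?_
  rw [Finset.coe_range, Set.mem_Iio]
  by_contra hlt
  exact hb (by simp only [hf b (not_lt.mp hlt), map_zero])

theorem exists_annihilationZ_eq_zero (f : Sym) :
    ∃ d : ℕ, ∀ b : ℕ, d ≤ b → annihilationZ b f = 0 := by
  obtain ⟨d, hd⟩ := annihilation_eq_zero f
  exact ⟨d + 1, fun b hb => by rw [annihilationZ_natCast]; exact hd b (by omega)⟩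

/-- The normally ordered product `:B_m B_n:`, truncated to terms with indices below `K`. -/
def normalProduct (K : ℕ) (m n : ℤ) : Module.End ℂ Sym :=
  ∑ b ∈ Finset.range K, ∑ c ∈ Finset.range K,
    creationZ (m + b) * creationZ (n + c) * (annihilationZ b * annihilationZ c)

theorem normalProduct_comm (K : ℕ) (m n : ℤ) : normalProduct K m n = normalProduct K n m := by
  unfold normalProduct
  rw [Finset.sum_comm]
  refine Finset.sum_congr rfl fun c _ => Finset.sum_congr rfl fun b _ => ?_
  rw [(creationZ_commute (m + b) (n + c)).eq,
    (annihilationZ_commute b c).eq]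

/-- Coefficient form of B(s)B(t) = (1 - t/s) :B(s)B(t):. Every large `K` is allowed, so that two
such expansions can be compared at a common truncation. -/
theorem B_mul_B_apply (m n : ℤ) (f : Sym) : ∃ K₀ : ℕ, ∀ K, K₀ ≤ K →
    B m (B n f) = normalProduct K m n f - normalProduct K (m + 1) (n - 1) f := by
  obtain ⟨d, hd⟩ := exists_annihilationZ_eq_zero f
  obtain ⟨e, he⟩ := exists_annihilationZ_eq_zero (B n f)
  refine ⟨max d e, fun K hK => ?_⟩
  have hdK : ∀ b : ℕ, K ≤ b → annihilationZ b f = 0 :=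
    fun b hb => hd b ((le_max_left _ _).trans (hK.trans hb))
  -- The outer sum runs one step further than the inner one: in the second half `b` is shifted down
  -- by one, where the term `b = 0` vanishes, while in the first half the extra term `b = K`
  -- vanishes.
  have heK : ∀ b : ℕ, K + 1 ≤ b → annihilationZ b (B n f) = 0 :=
    fun b hb => he b ((le_max_right _ _).trans (hK.trans (by omega)))
  have hdK' : ∀ c : ℕ, annihilationZ K (annihilationZ c f) = 0 := fun c => by
    rw [← Module.End.mul_apply,
      (annihilationZ_commute K c).eq, Module.End.mul_apply,
      hdK K le_rfl, map_zero]
  rw [B_apply_eq_sum m heK, B_apply_eq_sum n hdK]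
  have hterm : ∀ b : ℕ, creationZ (m + b) (annihilationZ b
      (∑ c ∈ Finset.range K, creationZ (n + c) (annihilationZ c f))) =
      (∑ c ∈ Finset.range K,
        creationZ (m + b) (creationZ (n + c) (annihilationZ b (annihilationZ c f)))) -
      ∑ c ∈ Finset.range K,
        creationZ (m + b) (creationZ (n - 1 + c) (annihilationZ (b - 1) (annihilationZ c f))) :=
      fun b => by
    rw [map_sum, map_sum, ← Finset.sum_sub_distrib]
    refine Finset.sum_congr rfl fun c _ => ?_
    rw [← Module.End.mul_apply (annihilationZ b), annihilationZ_mul_creationZ, LinearMap.sub_apply,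
      map_sub, show n + c - 1 = n - 1 + c by ring]
    rfl
  rw [Finset.sum_congr rfl fun b _ => hterm b, Finset.sum_sub_distrib, Finset.sum_range_succ,
    Finset.sum_range_succ' (fun b : ℕ => ∑ c ∈ Finset.range K,
      creationZ (m + b) (creationZ (n - 1 + c) (annihilationZ (b - 1) (annihilationZ c f))))]
  have hlast : ∑ c ∈ Finset.range K,
      creationZ (m + K) (creationZ (n + c) (annihilationZ K (annihilationZ c f))) = 0 :=
    Finset.sum_eq_zero fun c _ => by rw [hdK', map_zero, map_zero]
  have hfirst : ∑ c ∈ Finset.range K, creationZ (m + (0 : ℕ))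
      (creationZ (n - 1 + c) (annihilationZ ((0 : ℕ) - 1) (annihilationZ c f))) = 0 :=
    Finset.sum_eq_zero fun c _ => by
      rw [annihilationZ_of_neg (by simp), LinearMap.zero_apply, map_zero, map_zero]
  rw [hlast, hfirst, add_zero, add_zero]
  simp only [normalProduct, LinearMap.sum_apply, Module.End.mul_apply]
  congr 1
  refine Finset.sum_congr rfl fun b _ => Finset.sum_congr rfl fun c _ => ?_
  rw [show m + ((b + 1 : ℕ) : ℤ) = m + 1 + b by push_cast; ring,
    show ((b + 1 : ℕ) : ℤ) - 1 = b by push_cast; ring]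

theorem B_mul_B (m n : ℤ) : B m * B n = -(B (n - 1) * B (m + 1)) := by
  refine LinearMap.ext fun f => ?_
  obtain ⟨K₁, h₁⟩ := B_mul_B_apply m n f
  obtain ⟨K₂, h₂⟩ := B_mul_B_apply (n - 1) (m + 1) f
  rw [LinearMap.neg_apply, Module.End.mul_apply, Module.End.mul_apply,
    h₁ _ (le_max_left K₁ K₂), h₂ _ (le_max_right K₁ K₂), normalProduct_comm _ (n - 1),
    sub_add_cancel, add_sub_cancel_right, normalProduct_comm _ n, neg_sub]

/-- For these indices the Bernstein relation says that the product equals its own negative. -/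
theorem B_sub_one_mul_B (n : ℤ) : B (n - 1) * B n = 0 := by
  have h := B_mul_B (n - 1) n
  rw [sub_add_cancel] at h
  have h2 : (2 : ℂ) • (B (n - 1) * B n) = 0 := by
    rw [two_smul]
    exact eq_neg_iff_add_eq_zero.mp h
  exact (smul_eq_zero.mp h2).resolve_left two_ne_zero

theorem BComp_append (μ ν : List ℤ) : BComp (μ ++ ν) = BComp μ * BComp ν := by
  simp [BComp]

end Bernstein
end

/-! ### The three relations between words -/

open Bernstein Bernstein.Letter in
theorem proposition3p1 :
    (∀ k : ℕ, 0 < k →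
      WordRel ([R] ++ (Lpow k ++ [U] ++ Rpow (k - 1))) 1
        ((Lpow (k - 1) ++ [U] ++ Rpow (k - 2)) ++ [R]) ∧
      WordRel ([U] ++ (Lpow k ++ [U] ++ Rpow (k - 1))) (-1)
        ((Lpow (k - 1) ++ [U] ++ Rpow (k - 2)) ++ [U])) ∧
    WordRelZero [U, L, U] := by
  refine ⟨fun k _ => ⟨fun a c => ⟨_, _, isCodeOf_extend _, isCodeOf_extend _, ?_⟩,
    fun a c => ⟨_, _, isCodeOf_extend _, isCodeOf_extend _, ?_⟩⟩,
    fun a c => ⟨_, isCodeOf_extend _, ?_⟩⟩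
  · simp only [Lpow, upSteps_append, endPos_append, upSteps_Rpow, endPos_Rpow, upSteps, endPos,
      List.append_nil, List.nil_append]
    -- The prefix `a` matters only through its up steps and the abscissa at which it ends.
    generalize endPos 0 a = x
    rw [show x + 1 + -(k : ℤ) = x + -((k : ℤ) - 1) by ring,
      show x + -((k : ℤ) - 1) + (k - 2) + 1 = x + -((k : ℤ) - 1) + (k - 1) by ring]
    simp
  · simp only [Lpow, upSteps_append, endPos_append, upSteps_Rpow, endPos_Rpow, upSteps, endPos,
      List.append_nil, List.nil_append, List.reverse_append, List.reverse_singleton, BComp_append]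
    generalize endPos 0 a = x
    -- The lower up step, at `x`, gives the right-hand factor. Both words end at `x - 1`, so `c`
    -- contributes the same parts on both sides.
    have h := B_mul_B (x + -(k : ℤ)) x
    rw [show x + -((k : ℤ) - 1) + (k - 2) = x - 1 by ring,
      show x + -(k : ℤ) + (k - 1) = x - 1 by ring,
      show x + -((k : ℤ) - 1) = x + -(k : ℤ) + 1 by ring]
    simp only [BComp, List.map_cons, List.map_nil, List.prod_cons, List.prod_nil, mul_one] at *
    rw [h]
    simp [end_neg_mul, end_mul_neg]
  · simp only [upSteps_append, List.reverse_append, BComp_append]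
    generalize endPos 0 a = x
    have : BComp (upSteps x [U, L, U]).reverse = 0 := by
      simpa [upSteps, BComp] using B_sub_one_mul_B x
    rw [this, zero_mul, mul_zero]
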